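/- Let $\Gamma=\mathrm{Diff}^+(S^1)$ be the Fréchet Lie group of orientation-preserving diffeomorphisms of the circle; for $\gamma\in\Gamma$ let $\gamma'\colon S^1\to\mathbb R_{>0}$ be its derivative with respect to the angle. Let $F=S^1\times\mathbb R_{>0}$ be the oriented frame bundle of $S^1$, with points $(\theta,v)$, with the left action $\gamma\cdot(\theta,v)=(\gamma(\theta),\gamma'(\theta)v)$ of $\Gamma$ and the commuting right action $(\theta,v)\cdot x=(\theta,e^xv)$ of $\mathbb R$. Consider the bisimplicial Fréchet manifold $\Gamma^p\times F\times\mathbb R^q$ that resolves both actions. Its horizontal faces $d^h_i\colon \Gamma^{p+1}\times F\times\mathbb R^q\to\Gamma^p\times F\times\mathbb R^q$, $0\le i\le p+1$, drop $\gamma_1$ for $i=0$, replace $\gamma_i,\gamma_{i+1}$ by $\gamma_i\circ\gamma_{i+1}$ for $0<i<p+1$, and for $i=p+1$ remove $\gamma_{p+1}$ and let it act on $F$. Its vertical faces $d^v_i\colon \Gamma^p\times F\times\mathbb R^{q+1}\to\Gamma^p\times F\times\mathbb R^q$, $0\le i\le q+1$, remove $x_1$ and let it act on $F$ for $i=0$,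 replace $x_i,x_{i+1}$ by $x_i+x_{i+1}$ for $0<i<q+1$, and drop $x_{q+1}$ for $i=q+1$. Let $\mathrm{Tot}$ be the total complex of the double complex $\Omega^1(\Gamma^p\times F\times\mathbb R^q)$ of smooth one-forms: $$\mathrm{Tot}^n=\bigoplus_{p+q+1=n}\Omega^1(\Gamma^p\times F\times\mathbb R^q),\qquad d=d^h+(-1)^pd^v,\qquad d^h=\sum_i(-1)^i(d^h_i)^*,\quad d^v=\sum_i(-1)^i(d^v_i)^*.$$ Write elements of $\mathrm{Tot}^3=\Omega^1(F\times\mathbb R^2)\oplus\Omega^1(\Gamma\times F\times\mathbb R)\oplus\Omega^1(\Gamma^2\times F)$ as triples and elements of $\mathrm{Tot}^2=\Omega^1(F\times\mathbb R)\oplus\Omega^1(\Gamma\times F)$ as pairs. Lemma. The elements $$z_1=(x_1\,dx_2,\,0,\,0),\qquad z_2=(0,\,0,\,\log(\gamma_1'\circ\gamma_2)\,d\log\gamma_2')$$ of $\mathrm{Tot}^3$, where $\gamma_1'\circ\gamma_2$ and $\gamma_2'$ are evaluated at $\theta$, are cocycles, and they are cohomologous. Explicitly, $$z_2-z_1=(-x_1\,dx_2,\,0,\,\log(\gamma_1'\circ\gamma_2)\,d\log\gamma_2')=d\beta$$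 for the cochain $\beta=(-\log v\,dx,\ \log\gamma'\,d\log v)\in\mathrm{Tot}^2$. -/

import Mathlib

open scoped Manifold ContDiff
open Diffeology

noncomputable section

namespace BottThurston

/-! ### Smooth structures

The spaces `Γ^p × F × ℝ^q` are Fréchet manifolds.  Such a manifold `X` is recorded by its smooth maps
`ℝⁿ → X` from Cartesian spaces, that is, by its canonical diffeology; this is the sheaf
`Map(-, X)` on the site of smooth manifolds, restricted to Cartesian spaces. -/

/-- The Cartesian test spaces. -/
abbrev E (n : ℕ) : Type := EuclideanSpace ℝ (Fin n)

/-- A map into a product is smooth iff both of its components are. -/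
instance prodDiffeology {X Y : Type*} [DiffeologicalSpace X] [DiffeologicalSpace Y] :
    DiffeologicalSpace (X × Y) where
  plots n := {p | IsPlot (fun u => (p u).1) ∧ IsPlot (fun u => (p u).2)}
  constant_plots x := ⟨isPlot_const, isPlot_const⟩
  plot_reparam hp hf := ⟨isPlot_reparam hp.1 hf, isPlot_reparam hp.2 hf⟩
  locality hp :=
    ⟨DiffeologicalSpace.locality fun x =>
      let ⟨u, hu, hx, h⟩ := hp x
      ⟨u, hu, hx, fun hfu hf => (h hfu hf).1⟩,
    DiffeologicalSpace.locality fun x =>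
      let ⟨u, hu, hx, h⟩ := hp x
      ⟨u, hu, hx, fun hfu hf => (h hfu hf).2⟩⟩

/-- A map into a product is smooth iff all of its components are. -/
instance piDiffeology {ι : Type*} {X : ι → Type*} [∀ i, DiffeologicalSpace (X i)] :
    DiffeologicalSpace (∀ i, X i) where
  plots n := {p | ∀ i, IsPlot (fun u => p u i)}
  constant_plots x := fun _ => isPlot_const
  plot_reparam hp hf := fun i => isPlot_reparam (hp i) hf
  locality hp := fun i => DiffeologicalSpace.locality fun x =>
      let ⟨u, hu, hx, h⟩ := hp x
      ⟨u, hu, hx, fun hfu hf => h hfu hf i⟩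

/-- A map into a subset is smooth iff it is smooth into the ambient space. -/
instance subtypeDiffeology {X : Type*} [DiffeologicalSpace X] (s : X → Prop) :
    DiffeologicalSpace {x // s x} where
  plots n := {p | IsPlot (fun u => (p u : X))}
  constant_plots x := isPlot_const
  plot_reparam hp hf := isPlot_reparam hp hf
  locality hp := DiffeologicalSpace.locality fun x =>
      let ⟨u, hu, hx, h⟩ := hp x
      ⟨u, hu, hx, fun hfu hf => h hfu hf⟩

/-- The smooth maps `ℝⁿ → S¹` are the smooth maps of manifolds. -/
instance circleDiffeology : DiffeologicalSpace Circle := .ofCorePlotsOn {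
  isPlotOn := fun {n u} _ p => ContMDiffOn 𝓘(ℝ, E n) (𝓡 1) ∞ p u
  isPlotOn_congr := fun _ _ _ h => ⟨fun hp => hp.congr fun x hx => (h hx).symm,
    fun hp => hp.congr h⟩
  isPlot := fun {n} p => ContMDiff 𝓘(ℝ, E n) (𝓡 1) ∞ p
  isPlotOn_univ := contMDiffOn_univ
  isPlot_const := fun _ => contMDiff_const
  isPlotOn_reparam := fun _ _ _ h hp hf => hp.comp hf.contMDiffOn h
  locality := fun _ _ h x hx => by
    obtain ⟨v, hv, hxv, h'⟩ := h x hx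
    exact ((h' x hxv).contMDiffAt (hv.mem_nhds hxv)).contMDiffWithinAt }

/-- The smooth structure of the diffeomorphism group of the circle (a Fréchet Lie group, open in the
Fréchet manifold `C^∞(S¹, S¹)`): a map `c : U → Diff(S¹)` is smooth iff `(u, θ) ↦ c u θ` is a smooth map
`U × S¹ → S¹`. -/
instance diffDiffeology : DiffeologicalSpace (Circle ≃ₘ⟮𝓡 1, 𝓡 1⟯ Circle) := .ofCorePlotsOn {
  isPlotOn := fun {n u} _ c => ContMDiffOn (𝓘(ℝ, E n).prod (𝓡 1)) (𝓡 1) ∞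
    (fun z : E n × Circle => c z.1 z.2) (u ×ˢ Set.univ)
  isPlotOn_congr := fun _ p q h => by
    constructor
    · intro hp; exact hp.congr fun x hx => by simp [h hx.1]
    · intro hp; exact hp.congr fun x hx => by simp [h hx.1]
  isPlot := fun {n} c => ContMDiff (𝓘(ℝ, E n).prod (𝓡 1)) (𝓡 1) ∞
    (fun z : E n × Circle => c z.1 z.2)
  isPlotOn_univ := by
    intro n p; simp [contMDiffOn_univ]
  isPlot_const := fun γ => γ.contMDiff.comp contMDiff_snd
  isPlotOn_reparam := fun {n m u v _} _ {p f} h hp hf => by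
    have : ContMDiffOn (𝓘(ℝ, E m).prod (𝓡 1)) (𝓘(ℝ, E n).prod (𝓡 1)) ∞
      (fun z : E m × Circle => (f z.1, z.2)) (v ×ˢ Set.univ) :=
      (hf.contMDiffOn.comp contMDiff_fst.contMDiffOn fun z hz => hz.1).prodMk
        contMDiff_snd.contMDiffOn
    exact hp.comp this fun z hz => ⟨h hz.1, trivial⟩
  locality := fun {n u} _ {p} h z hz => by
    obtain ⟨v, hv, hxv, h'⟩ := h z.1 hz.1
    exact ((h' z ⟨hxv, trivial⟩).contMDiffAt
      ((hv.prod isOpen_univ).mem_nhds ⟨hxv, trivial⟩)).contMDiffWithinAt }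

/-! ### Differential one-forms -/

/-- A differential one-form on `X` is a compatible family of smooth one-forms `α c` on `ℝⁿ`, one for
each smooth map `c : ℝⁿ → X` (the pullback of the form along `c`), with `α (c ∘ f) = f^* (α c)` for all
smooth `f : ℝᵐ → ℝⁿ`: a map of sheaves from `Map(-, X)` to `Ω¹`. -/
def oneFormSubmodule (X : Type) [DiffeologicalSpace X] :
    Submodule ℝ (∀ n : ℕ, {p : E n → X // IsPlot p} → E n → (E n →L[ℝ] ℝ)) where
  carrier := {α | (∀ n p, ContDiff ℝ ∞ (α n p)) ∧
    ∀ (m n : ℕ) (p : {p : E n → X // IsPlot p}) (f : E m → E n) (hf : ContDiff ℝ ∞ f) (u : E m),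
      α m ⟨p.1 ∘ f, isPlot_reparam p.2 hf⟩ u = (α n p (f u)).comp (fderiv ℝ f u)}
  zero_mem' := ⟨fun _ _ => contDiff_const, fun _ _ _ _ _ _ => by simp⟩
  add_mem' := fun ha hb => ⟨fun n p => (ha.1 n p).add (hb.1 n p), fun m n p f hf u => by
    simp [ha.2 m n p f hf u, hb.2 m n p f hf u, ContinuousLinearMap.add_comp]⟩
  smul_mem' := fun c α h => ⟨fun n p => (h.1 n p).const_smul c, fun m n p f hf u => by
    simp [h.2 m n p f hf u]⟩

/-- The space `Ω¹(X)`. -/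
def OneForm (X : Type) [DiffeologicalSpace X] : Type := oneFormSubmodule X

instance (X : Type) [DiffeologicalSpace X] : AddCommGroup (OneForm X) :=
  inferInstanceAs (AddCommGroup (oneFormSubmodule X))

instance (X : Type) [DiffeologicalSpace X] : Module ℝ (OneForm X) :=
  inferInstanceAs (Module ℝ (oneFormSubmodule X))

section
variable {X Y : Type} [DiffeologicalSpace X] [DiffeologicalSpace Y]

/-- The pullback `φ^* : Ω¹(Y) → Ω¹(X)` along a smooth map `φ : X → Y`. -/
def pullback (φ : X → Y) (hφ : DSmooth φ) : OneForm Y →ₗ[ℝ] OneForm X where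
  toFun α := ⟨fun n p => α.1 n ⟨φ ∘ p.1, hφ n p.1 p.2⟩,
    fun n _ => α.2.1 n _, fun m n p f hf u => α.2.2 m n ⟨φ ∘ p.1, hφ n p.1 p.2⟩ f hf u⟩
  map_add' _ _ := rfl
  map_smul' _ _ := rfl

/-- The exact one-form `df` of a smooth function `f`. -/
def dForm (f : X → ℝ) (hf : DSmooth f) : OneForm X :=
  ⟨fun _ c u => fderiv ℝ (fun w => f (c.1 w)) u,
    fun n p => (hf n p.1 p.2).contDiff.fderiv_right (by simp),
    fun m n p g hg u => by
      have h1 : DifferentiableAt ℝ (fun w => f (p.1 w)) (g u) :=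
        (hf n p.1 p.2).contDiff.contDiffAt.differentiableAt (by simp)
      have h2 : DifferentiableAt ℝ g u := hg.contDiffAt.differentiableAt (by simp)
      exact fderiv_comp u h1 h2⟩

/-- The product `f α` of a smooth function and a one-form. -/
def mulForm (f : X → ℝ) (hf : DSmooth f) (α : OneForm X) : OneForm X :=
  ⟨fun n p u => f (p.1 u) • α.1 n p u,
    fun n p => ((hf n p.1 p.2).contDiff).smul (α.2.1 n p),
    fun m n p g hg u => by
      simp [α.2.2 m n p g hg u]⟩

end

/-! ### Orientation-preserving diffeomorphisms of the circle -/

/-- The derivative `γ'(θ)` of a smooth map `γ : S¹ → S¹` with respect to the angle: the number with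
`d/dt γ(θ e^{it}) = γ'(θ) * i * γ(θ)` at `t = 0`. -/
def circleDeriv (γ : Circle → Circle) (θ : Circle) : ℝ :=
  (deriv (fun t : ℝ => (γ (θ * Circle.exp t) : ℂ)) 0 / (Complex.I * γ θ)).re


/-- `circleDeriv γ` is what the derivative `g'` of a lift `g : ℝ → ℝ` of `γ` descends to. -/
theorem circleDeriv_lift (γ : Circle → Circle) (g : ℝ → ℝ) (hg : Differentiable ℝ g)
    (h : ∀ t, γ (Circle.exp t) = Circle.exp (g t)) (t : ℝ) :
    circleDeriv γ (Circle.exp t) = deriv g t := by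
  have h1 : (fun s : ℝ => (γ (Circle.exp t * Circle.exp s) : ℂ)) =
      fun s : ℝ => Complex.exp (g (t + s) * Complex.I) := by
    funext s
    rw [← Circle.exp_add, h, Circle.coe_exp]
  have h2 : HasDerivAt (fun s : ℝ => Complex.exp (g (t + s) * Complex.I))
      (Complex.exp (g (t + 0) * Complex.I) * ((deriv g t : ℝ) * Complex.I)) 0 := by
    have h3 : HasDerivAt (fun s : ℝ => g (t + s)) (deriv g t) 0 := by
      have := (hg (t + 0)).hasDerivAt.comp_const_add t 0
      simpa using this
    exact ((h3.ofReal_comp).mul_const Complex.I).cexp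
  rw [circleDeriv, h1, h2.deriv, h, Circle.coe_exp, add_zero]
  have h4 : Complex.exp (g t * Complex.I) ≠ 0 := Complex.exp_ne_zero _
  have h5 : Complex.exp (g t * Complex.I) * ((deriv g t : ℝ) * Complex.I) /
      (Complex.I * Complex.exp (g t * Complex.I)) = ((deriv g t : ℝ) : ℂ) := by
    field_simp
  rw [h5, Complex.ofReal_re]

theorem contMDiff_coe_circle : ContMDiff (𝓡 1) 𝓘(ℝ, ℂ) ∞ (fun z : Circle => (z : ℂ)) :=
  haveI : Fact (Module.finrank ℝ ℂ = 1 + 1) := ⟨Complex.finrank_real_complex⟩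
  contMDiff_coe_sphere (E := ℂ)

theorem contDiff_curve (f : Circle ≃ₘ⟮𝓡 1, 𝓡 1⟯ Circle) (θ : Circle) :
    ContDiff ℝ ∞ (fun t : ℝ => (f (θ * Circle.exp t) : ℂ)) :=
  (contMDiff_coe_circle.comp (f.contMDiff.comp
    (contMDiff_const.mul contMDiff_circleExp))).contDiff

theorem circleDeriv_comp (f g : Circle ≃ₘ⟮𝓡 1, 𝓡 1⟯ Circle) (θ : Circle) :
    circleDeriv (fun z => f (g z)) θ = circleDeriv f (g θ) * circleDeriv g θ := by
  set w : Circle := g θ with hw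
  set h : ℝ → Circle := fun t => g (θ * Circle.exp t) with hh
  have h0 : h 0 = w := by simp [hh, hw]
  have hd : HasDerivAt (fun t => (h t : ℂ)) (deriv (fun t => (h t : ℂ)) 0) 0 :=
    ((contDiff_curve g θ).contDiffAt.differentiableAt (by simp)).hasDerivAt
  set D := deriv (fun t => (h t : ℂ)) 0 with hD
  let s : ℝ → ℝ := fun t => Complex.arg ((h t / w : Circle) : ℂ)
  have hs : ∀ t, h t = w * Circle.exp (s t) := fun t => by
    simp only [s]; rw [Circle.exp_arg]; simp
  have s0 : s 0 = 0 := by simp [s, h0]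
  have hsd : HasDerivAt s ((D / w / 1).im) 0 := by
    have h1 : HasDerivAt (fun t => ((h t / w : Circle) : ℂ)) (D / w) 0 := by
      simpa using hd.div_const (w : ℂ)
    have e1 : ((h 0 / w : Circle) : ℂ) = 1 := by simp [h0]
    have h2 := h1.clog_real (by rw [e1]; simp)
    rw [e1] at h2
    have h3 := (Complex.imCLM.hasFDerivAt.comp_hasDerivAt (0 : ℝ) h2)
    simpa [Function.comp_def, Complex.log_im, s] using h3
  set σ := (D / w / 1).im with hσ
  have e2 : D = w * (Complex.I * σ) := by
    have h1 : HasDerivAt (fun t => (h t : ℂ)) (w * (Complex.exp (s 0 * Complex.I) * (σ * Complex.I))) 0 := by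
      have : (fun t => (h t : ℂ)) = fun t => (w : ℂ) * Complex.exp (s t * Complex.I) := by
        funext t; rw [hs t]; simp [Circle.coe_exp]
      rw [this]
      exact ((hsd.ofReal_comp.mul_const Complex.I).cexp).const_mul _
    rw [hd.unique h1, s0]; simp; ring
  have e3 : circleDeriv g θ = σ := by
    have : D / (Complex.I * w) = (σ : ℂ) := by
      have := Circle.coe_ne_zero w
      rw [e2]; field_simp
    rw [circleDeriv]
    change (D / (Complex.I * w)).re = σ
    rw [this, Complex.ofReal_re]
  have e4 : deriv (fun t : ℝ => (f (g (θ * Circle.exp t)) : ℂ)) 0 =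
      σ • deriv (fun t : ℝ => (f (w * Circle.exp t) : ℂ)) 0 := by
    have h1 : (fun t : ℝ => (f (g (θ * Circle.exp t)) : ℂ)) =
        (fun t : ℝ => (f (w * Circle.exp t) : ℂ)) ∘ s := by
      funext t
      have := hs t
      simp only [hh] at this
      simp only [Function.comp, this]
    have h2 : HasDerivAt (fun t : ℝ => (f (w * Circle.exp t) : ℂ))
        (deriv (fun t : ℝ => (f (w * Circle.exp t) : ℂ)) 0) (s 0) := by
      rw [s0]
      exact ((contDiff_curve f w).contDiffAt.differentiableAt (by simp)).hasDerivAt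
    rw [h1]
    exact (h2.scomp 0 hsd).deriv
  rw [e3, circleDeriv, e4, circleDeriv, ← hw, Complex.real_smul, mul_div_assoc,
    Complex.re_ofReal_mul, mul_comm]

theorem circleDeriv_id (θ : Circle) : circleDeriv (fun z => z) θ = 1 := by
  obtain ⟨t, rfl⟩ : ∃ t, θ = Circle.exp t := ⟨_, (Circle.exp_arg θ).symm⟩
  simpa using circleDeriv_lift (fun z => z) (fun t => t) differentiable_id (fun _ => rfl) t

/-- The group `Γ = Diff⁺(S¹)`. -/
def DiffPlus : Type :=
  {γ : Circle ≃ₘ⟮𝓡 1, 𝓡 1⟯ Circle // ∀ θ, 0 < circleDeriv γ θ}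

namespace DiffPlus

instance : FunLike DiffPlus Circle Circle where
  coe γ := γ.1
  coe_injective _ _ h := Subtype.ext (Diffeomorph.ext fun x => congrFun h x)

/-- The function `γ' : S¹ → ℝ_{>0}`. -/
def deriv (γ : DiffPlus) (θ : Circle) : ℝ := circleDeriv γ θ

theorem deriv_pos (γ : DiffPlus) (θ : Circle) : 0 < γ.deriv θ := γ.2 θ

/-- The group law is composition. -/
instance : Group DiffPlus where
  mul γ₁ γ₂ := ⟨γ₂.1.trans γ₁.1, fun θ => by
    have := circleDeriv_comp γ₁.1 γ₂.1 θ
    change 0 < circleDeriv (fun z => γ₁.1 (γ₂.1 z)) θ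
    rw [this]
    exact mul_pos (γ₁.2 _) (γ₂.2 _)⟩
  one := ⟨Diffeomorph.refl _ _ _, fun θ => by
    change 0 < circleDeriv (fun z => z) θ
    rw [circleDeriv_id]; exact one_pos⟩
  inv γ := ⟨γ.1.symm, fun θ => by
    have h := circleDeriv_comp γ.1 γ.1.symm θ
    simp only [Diffeomorph.apply_symm_apply, circleDeriv_id] at h
    exact pos_of_mul_pos_right (h ▸ one_pos) (γ.2 _).le⟩
  mul_assoc _ _ _ := rfl
  one_mul _ := rfl
  mul_one _ := rfl
  inv_mul_cancel γ := Subtype.ext (Diffeomorph.ext fun x => γ.1.symm_apply_apply x)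

@[simp] theorem mul_apply (γ₁ γ₂ : DiffPlus) (θ : Circle) : (γ₁ * γ₂) θ = γ₁ (γ₂ θ) := rfl

theorem deriv_mul (γ₁ γ₂ : DiffPlus) (θ : Circle) :
    (γ₁ * γ₂).deriv θ = γ₁.deriv (γ₂ θ) * γ₂.deriv θ := circleDeriv_comp γ₁.1 γ₂.1 θ

instance : DiffeologicalSpace DiffPlus := inferInstanceAs (DiffeologicalSpace (Subtype _))

theorem dSmooth_mul : DSmooth (fun z : DiffPlus × DiffPlus => z.1 * z.2) := by
  intro n p hp
  have h1 : ContMDiff (𝓘(ℝ, E n).prod (𝓡 1)) (𝓡 1) ∞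
    (fun z : E n × Circle => (p z.1).1.1 z.2) := hp.1
  have h2 : ContMDiff (𝓘(ℝ, E n).prod (𝓡 1)) (𝓡 1) ∞
    (fun z : E n × Circle => (p z.1).2.1 z.2) := hp.2
  exact h1.comp (contMDiff_fst.prodMk h2)

theorem dSmooth_apply : DSmooth (fun z : DiffPlus × Circle => z.1 z.2) := by
  intro n p hp
  have h1 : ContMDiff (𝓘(ℝ, E n).prod (𝓡 1)) (𝓡 1) ∞
    (fun z : E n × Circle => (p z.1).1.1 z.2) := hp.1
  have h2 : ContMDiff 𝓘(ℝ, E n) (𝓡 1) ∞ (fun u => (p u).2) := hp.2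
  exact h1.comp (contMDiff_id.prodMk h2)

theorem dSmooth_deriv : DSmooth (fun z : DiffPlus × Circle => z.1.deriv z.2) := by
  intro n p hp
  have h1 : ContMDiff (𝓘(ℝ, E n).prod (𝓡 1)) (𝓡 1) ∞
    (fun z : E n × Circle => (p z.1).1.1 z.2) := hp.1
  have h2 : ContMDiff 𝓘(ℝ, E n) (𝓡 1) ∞ (fun u => (p u).2) := hp.2
  let G : E n × ℝ → ℂ := fun z => ((p z.1).1 ((p z.1).2 * Circle.exp z.2) : ℂ)
  have hG : ContDiff ℝ ∞ G := by
    have a1 : ContMDiff 𝓘(ℝ, E n × ℝ) 𝓘(ℝ, E n) ∞ (fun z : E n × ℝ => z.1) :=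
      contDiff_fst.contMDiff
    have a2 : ContMDiff 𝓘(ℝ, E n × ℝ) 𝓘(ℝ, ℝ) ∞ (fun z : E n × ℝ => z.2) :=
      contDiff_snd.contMDiff
    have a3 : ContMDiff 𝓘(ℝ, E n × ℝ) (𝓡 1) ∞
        (fun z : E n × ℝ => (p z.1).2 * Circle.exp z.2) :=
      (h2.comp a1).mul (contMDiff_circleExp.comp a2)
    exact (contMDiff_coe_circle.comp (h1.comp (a1.prodMk a3))).contDiff
  have hd : ∀ u, (p u).1.deriv (p u).2 =
      (fderiv ℝ G (u, 0) (0, 1) / (Complex.I * G (u, 0))).re := by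
    intro u
    have b1 : HasDerivAt (fun t : ℝ => ((u, t) : E n × ℝ)) (0, 1) 0 :=
      (hasDerivAt_const _ _).prodMk (hasDerivAt_id _)
    have b2 : HasFDerivAt G (fderiv ℝ G (u, 0)) (u, 0) :=
      (hG.contDiffAt.differentiableAt (by simp)).hasFDerivAt
    have b3 := (b2.comp_hasDerivAt (0 : ℝ) b1).deriv
    rw [← b3]
    simp [DiffPlus.deriv, circleDeriv, G, Function.comp_def]
  have hI : ContDiff ℝ ∞ (fun u : E n => ((u, 0) : E n × ℝ)) := contDiff_id.prodMk contDiff_const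
  have hsm : ContDiff ℝ ∞ (fun u => (fderiv ℝ G (u, 0) (0, 1) / (Complex.I * G (u, 0))).re) := by
    have c1 : ContDiff ℝ ∞ (fun u => fderiv ℝ G (u, 0) (0, 1)) :=
      ((hG.fderiv_right (m := ∞) (by simp)).comp hI).clm_apply contDiff_const
    have c2 : ContDiff ℝ ∞ (fun u => Complex.I * G (u, 0)) := contDiff_const.mul (hG.comp hI)
    have c3 : ContDiff ℝ ∞ (fun u => fderiv ℝ G (u, 0) (0, 1) / (Complex.I * G (u, 0))) := by
      simp only [div_eq_mul_inv]
      exact c1.mul (c2.inv fun u => mul_ne_zero Complex.I_ne_zero (Circle.coe_ne_zero _))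
    exact Complex.reCLM.contDiff.comp c3
  rw [← funext hd] at hsm
  exact hsm.isPlot

end DiffPlus


section smooth
variable {X Y Z : Type} [DiffeologicalSpace X] [DiffeologicalSpace Y] [DiffeologicalSpace Z]

theorem dSmooth_fst : DSmooth (fun z : X × Y => z.1) := fun _ _ hp => hp.1

theorem dSmooth_snd : DSmooth (fun z : X × Y => z.2) := fun _ _ hp => hp.2

theorem dSmooth_prodMk {f : X → Y} {g : X → Z} (hf : DSmooth f) (hg : DSmooth g) :
    DSmooth (fun x => (f x, g x)) := fun n p hp => ⟨hf n p hp, hg n p hp⟩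

theorem dSmooth_eval {ι : Type} (i : ι) : DSmooth (fun z : ι → X => z i) := fun _ _ hp => hp i

theorem dSmooth_pi {ι : Type} {f : X → ι → Y} (hf : ∀ i, DSmooth (fun x => f x i)) :
    DSmooth f := fun n p hp i => hf i n p hp

theorem dSmooth_val (s : X → Prop) : DSmooth (fun z : {x // s x} => (z : X)) := fun _ _ hp => hp

theorem dSmooth_subtypeMk {s : Y → Prop} {f : X → Y} (hf : DSmooth f) (h : ∀ x, s (f x)) :
    DSmooth (fun x => (⟨f x, h x⟩ : {y // s y})) := hf

theorem dSmooth_add {f g : X → ℝ} (hf : DSmooth f) (hg : DSmooth g) :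
    DSmooth (fun x => f x + g x) :=
  fun n p hp => ((hf n p hp).contDiff.add (hg n p hp).contDiff).isPlot

theorem dSmooth_neg {f : X → ℝ} (hf : DSmooth f) : DSmooth (fun x => -f x) :=
  fun n p hp => ((hf n p hp).contDiff.neg).isPlot

theorem dSmooth_rmul {f g : X → ℝ} (hf : DSmooth f) (hg : DSmooth g) :
    DSmooth (fun x => f x * g x) :=
  fun n p hp => ((hf n p hp).contDiff.mul (hg n p hp).contDiff).isPlot

theorem dSmooth_exp {f : X → ℝ} (hf : DSmooth f) : DSmooth (fun x => Real.exp (f x)) :=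
  fun n p hp => ((hf n p hp).contDiff.exp).isPlot

theorem dSmooth_apply₂ {f : X → DiffPlus} {g : X → Circle} (hf : DSmooth f) (hg : DSmooth g) :
    DSmooth (fun x => f x (g x)) := by
  have h := DiffPlus.dSmooth_apply.comp (dSmooth_prodMk hf hg)
  exact h

theorem dSmooth_deriv₂ {f : X → DiffPlus} {g : X → Circle} (hf : DSmooth f) (hg : DSmooth g) :
    DSmooth (fun x => (f x).deriv (g x)) := by
  have h := DiffPlus.dSmooth_deriv.comp (dSmooth_prodMk hf hg)
  exact h

theorem dSmooth_log {f : X → ℝ} (hf : DSmooth f) (h : ∀ x, 0 < f x) :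
    DSmooth (fun x => Real.log (f x)) :=
  fun n p hp => ((hf n p hp).contDiff.log fun u => (h (p u)).ne').isPlot

end smooth

/-- The positive reals. -/
abbrev PosReal : Type := {v : ℝ // 0 < v}

/-- The oriented frame bundle `F = S¹ × ℝ_{>0}` of the circle, with points `(θ, v)`. -/
abbrev Frame : Type := Circle × PosReal

/-- The manifold `Γ^p × F × ℝ^q`, with points `(γ₁, …, γ_p, (θ, v), x₁, …, x_q)`; the indices are shifted
to start from zero. -/
abbrev Level (p q : ℕ) : Type := (Fin p → DiffPlus) × Frame × (Fin q → ℝ)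

/-- The left action `γ · (θ, v) = (γ(θ), γ'(θ) v)` of `Γ` on `F`. -/
def leftAct (γ : DiffPlus) (f : Frame) : Frame :=
  (γ f.1, ⟨γ.deriv f.1 * f.2, mul_pos (γ.deriv_pos _) f.2.2⟩)

/-- The right action `(θ, v) · x = (θ, e^x v)` of `ℝ` on `F`. -/
def rightAct (f : Frame) (x : ℝ) : Frame :=
  (f.1, ⟨Real.exp x * f.2, mul_pos (Real.exp_pos _) f.2.2⟩)

/-- The face maps `Γ^{p+1} × F × ℝ^q → Γ^p × F × ℝ^q` which resolve the action of `Γ`: the first one drops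
`γ₁`, the inner ones multiply neighbours `γ_i γ_{i+1}`, and the last one lets `γ_{p+1}` act on `F`.
(`j.contractNth` multiplies the entries `j` and `j + 1`, and for the last `j` it drops the last entry.) -/
def hFace (p q : ℕ) (i : Fin (p + 2)) (z : Level (p + 1) q) : Level p q :=
  Fin.cases (motive := fun _ => Level p q)
    (Fin.tail z.1, z.2.1, z.2.2)
    (fun j => (j.contractNth (· * ·) z.1,
      if j = Fin.last p then leftAct (z.1 j) z.2.1 else z.2.1, z.2.2)) i

/-- The face maps `Γ^p × F × ℝ^{q+1} → Γ^p × F × ℝ^q` which resolve the action of `ℝ`: the first one lets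
`x₁` act on `F`, the inner ones add neighbours `x_i + x_{i+1}`, and the last one drops `x_{q+1}`. -/
def vFace (p q : ℕ) (i : Fin (q + 2)) (z : Level p (q + 1)) : Level p q :=
  Fin.cases (motive := fun _ => Level p q)
    (z.1, rightAct z.2.1 (z.2.2 0), Fin.tail z.2.2)
    (fun j => (z.1, z.2.1, j.contractNth (· + ·) z.2.2)) i

theorem dSmooth_contractNth {X : Type} [DiffeologicalSpace X] {op : X → X → X}
    (hop : DSmooth (fun z : X × X => op z.1 z.2)) {n : ℕ} (j : Fin (n + 1)) :
    DSmooth (fun g : Fin (n + 1) → X => j.contractNth op g) := by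
  refine dSmooth_pi fun k => ?_
  unfold Fin.contractNth
  split_ifs
  · exact dSmooth_eval _
  · exact hop.comp (dSmooth_prodMk (dSmooth_eval _) (dSmooth_eval _))
  · exact dSmooth_eval _

theorem dSmooth_leftAct : DSmooth (fun z : DiffPlus × Frame => leftAct z.1 z.2) := by
  have h : DSmooth (fun z : DiffPlus × Frame => z.2.1) := dSmooth_fst.comp dSmooth_snd
  exact dSmooth_prodMk (dSmooth_apply₂ dSmooth_fst h)
    (dSmooth_subtypeMk (dSmooth_rmul (dSmooth_deriv₂ dSmooth_fst h)
      ((dSmooth_val _).comp (dSmooth_snd.comp dSmooth_snd))) _)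

theorem dSmooth_rightAct : DSmooth (fun z : Frame × ℝ => rightAct z.1 z.2) :=
  dSmooth_prodMk (dSmooth_fst.comp dSmooth_fst)
    (dSmooth_subtypeMk (dSmooth_rmul (dSmooth_exp dSmooth_snd)
      ((dSmooth_val _).comp (dSmooth_snd.comp dSmooth_fst))) _)

theorem dSmooth_hFace (p q : ℕ) (i : Fin (p + 2)) : DSmooth (hFace p q i) := by
  have h2 : DSmooth (fun z : Level (p + 1) q => z.2.1) := dSmooth_fst.comp dSmooth_snd
  have h3 : DSmooth (fun z : Level (p + 1) q => z.2.2) := dSmooth_snd.comp dSmooth_snd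
  refine Fin.cases ?_ (fun j => ?_) i
  · exact dSmooth_prodMk (dSmooth_pi fun k => (dSmooth_eval k.succ).comp dSmooth_fst)
      (dSmooth_prodMk h2 h3)
  · refine dSmooth_prodMk ((dSmooth_contractNth DiffPlus.dSmooth_mul j).comp dSmooth_fst)
      (dSmooth_prodMk ?_ h3)
    split_ifs
    · exact dSmooth_leftAct.comp (dSmooth_prodMk ((dSmooth_eval j).comp dSmooth_fst) h2)
    · exact h2

theorem dSmooth_vFace (p q : ℕ) (i : Fin (q + 2)) : DSmooth (vFace p q i) := by
  have h2 : DSmooth (fun z : Level p (q + 1) => z.2.1) := dSmooth_fst.comp dSmooth_snd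
  have h3 : DSmooth (fun z : Level p (q + 1) => z.2.2) := dSmooth_snd.comp dSmooth_snd
  refine Fin.cases ?_ (fun j => ?_) i
  · exact dSmooth_prodMk dSmooth_fst (dSmooth_prodMk
      (dSmooth_rightAct.comp (dSmooth_prodMk h2 ((dSmooth_eval 0).comp h3)))
      (dSmooth_pi fun k => (dSmooth_eval k.succ).comp h3))
  · exact dSmooth_prodMk dSmooth_fst (dSmooth_prodMk h2
      ((dSmooth_contractNth (dSmooth_add dSmooth_fst dSmooth_snd) j).comp h3))

/-- The entry `Ω¹(Γ^p × F × ℝ^q)` of the double complex. -/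
abbrev Cochain (p q : ℕ) : Type := OneForm (Level p q)

/-- The horizontal differential, the alternating sum of the pullbacks along the face maps. -/
def dH (p q : ℕ) : Cochain p q →ₗ[ℝ] Cochain (p + 1) q :=
  ∑ i : Fin (p + 2), (-1 : ℝ) ^ (i : ℕ) • pullback (hFace p q i) (dSmooth_hFace p q i)

/-- The vertical differential, the alternating sum of the pullbacks along the face maps. -/
def dV (p q : ℕ) : Cochain p q →ₗ[ℝ] Cochain p (q + 1) :=
  ∑ i : Fin (q + 2), (-1 : ℝ) ^ (i : ℕ) • pullback (vFace p q i) (dSmooth_vFace p q i)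

/-! ### The bisimplicial identities -/

theorem contractNth_contractNth {X : Type} (op : X → X → X)
    (hop : ∀ a b c, op (op a b) c = op a (op b c)) {n : ℕ} (i j : Fin (n + 1)) (h : i ≤ j)
    (g : Fin (n + 2) → X) :
    i.contractNth op (j.succ.contractNth op g) = j.contractNth op (i.castSucc.contractNth op g) := by
  ext k
  obtain ⟨i, hi⟩ := i
  obtain ⟨j, hj⟩ := j
  obtain ⟨k, hk⟩ := k
  simp only [Fin.mk_le_mk] at h
  simp only [Fin.contractNth, Fin.succ_mk, Fin.castSucc_mk]
  split_ifs <;> first | rfl | omega | simp_all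

theorem tail_contractNth_succ {X : Type} (op : X → X → X) {n : ℕ} (j : Fin (n + 1))
    (g : Fin (n + 2) → X) :
    Fin.tail (j.succ.contractNth op g) = j.contractNth op (Fin.tail g) := by
  ext k
  simp [Fin.tail, Fin.contractNth]

theorem tail_contractNth_zero {X : Type} (op : X → X → X) {n : ℕ}
    (g : Fin (n + 2) → X) :
    Fin.tail ((0 : Fin (n + 2)).contractNth op g) = Fin.tail (Fin.tail g) := by
  ext k
  simp [Fin.tail, Fin.contractNth]


theorem leftAct_mul (γ₁ γ₂ : DiffPlus) (f : Frame) :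
    leftAct (γ₁ * γ₂) f = leftAct γ₁ (leftAct γ₂ f) := by
  refine Prod.ext rfl (Subtype.ext ?_)
  simp only [leftAct, DiffPlus.deriv_mul]
  ring

theorem rightAct_add (f : Frame) (x y : ℝ) :
    rightAct f (x + y) = rightAct (rightAct f x) y := by
  refine Prod.ext rfl (Subtype.ext ?_)
  simp only [rightAct, Real.exp_add]
  ring

theorem leftAct_rightAct (γ : DiffPlus) (f : Frame) (x : ℝ) :
    leftAct γ (rightAct f x) = rightAct (leftAct γ f) x := by
  refine Prod.ext rfl (Subtype.ext ?_)
  simp only [leftAct, rightAct]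
  ring

theorem hFace_hFace (p q : ℕ) (i j : Fin (p + 2)) (h : i ≤ j) (z : Level (p + 2) q) :
    hFace p q i (hFace (p + 1) q j.succ z) = hFace p q j (hFace (p + 1) q i.castSucc z) := by
  obtain ⟨g, f, x⟩ := z
  induction i using Fin.cases with
  | zero =>
    induction j using Fin.cases with
    | zero =>
      simp only [hFace, Fin.cases_succ, Fin.castSucc_zero, Fin.cases_zero, tail_contractNth_zero]
      simp [Fin.ext_iff]
    | succ j =>
      simp [hFace, tail_contractNth_succ, Fin.ext_iff, Fin.tail]
  | succ i =>
    induction j using Fin.cases with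
    | zero => simp at h
    | succ j =>
      have h' : i ≤ j := by simpa using h
      have e := contractNth_contractNth (fun a b : DiffPlus => a * b) mul_assoc i j h' g
      refine Prod.ext e (Prod.ext ?_ rfl)
      simp only [hFace, Fin.cases_succ, ← Fin.succ_castSucc]
      obtain ⟨i, hi⟩ := i
      obtain ⟨j, hj⟩ := j
      simp only [Fin.mk_le_mk] at h'
      simp only [Fin.contractNth, Fin.ext_iff, Fin.succ_mk, Fin.castSucc_mk, Fin.val_last]
      split_ifs <;> first | rfl | omega | (simp_all [leftAct_mul])

theorem vFace_vFace (p q : ℕ) (i j : Fin (q + 2)) (h : i ≤ j) (z : Level p (q + 2)) :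
    vFace p q i (vFace p (q + 1) j.succ z) = vFace p q j (vFace p (q + 1) i.castSucc z) := by
  obtain ⟨g, f, x⟩ := z
  induction i using Fin.cases with
  | zero =>
    induction j using Fin.cases with
    | zero =>
      simp only [vFace, Fin.cases_succ, Fin.castSucc_zero, Fin.cases_zero, tail_contractNth_zero]
      simp [Fin.contractNth, Fin.tail, rightAct_add]
    | succ j =>
      simp [vFace, tail_contractNth_succ, Fin.contractNth, Fin.tail]
  | succ i =>
    induction j using Fin.cases with
    | zero => simp at h
    | succ j =>
      have h' : i ≤ j := by simpa using h
      have e := contractNth_contractNth (fun a b : ℝ => a + b) add_assoc i j h' x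
      exact Prod.ext rfl (Prod.ext rfl e)

theorem hFace_vFace (p q : ℕ) (i : Fin (p + 2)) (j : Fin (q + 2)) (z : Level (p + 1) (q + 1)) :
    hFace p q i (vFace (p + 1) q j z) = vFace p q j (hFace p (q + 1) i z) := by
  induction i using Fin.cases with
  | zero => induction j using Fin.cases <;> rfl
  | succ i =>
    induction j using Fin.cases with
    | zero =>
      refine Prod.ext rfl (Prod.ext ?_ rfl)
      simp only [hFace, vFace, Fin.cases_succ, Fin.cases_zero]
      split_ifs
      · exact leftAct_rightAct _ _ _
      · rfl
    | succ j => rfl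


theorem alternating_sum_eq_zero {M : Type} [AddCommGroup M] [Module ℝ M] {n : ℕ}
    (a : Fin (n + 1) → Fin (n + 2) → M)
    (h : ∀ i j : Fin (n + 1), i ≤ j → a i j.succ = a j i.castSucc) :
    ∑ j : Fin (n + 2), (-1 : ℝ) ^ (j : ℕ) • ∑ i : Fin (n + 1), (-1 : ℝ) ^ (i : ℕ) • a i j = 0 := by
  simp only [Finset.smul_sum, smul_smul, ← pow_add]
  rw [Finset.sum_comm, ← Finset.sum_product', Finset.univ_product_univ]
  let S : Finset (Fin (n + 1) × Fin (n + 2)) := {x | (x.2 : ℕ) ≤ (x.1 : ℕ)}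
  rw [← Finset.sum_add_sum_compl S, ← eq_neg_iff_add_eq_zero, ← Finset.sum_neg_distrib]
  refine Finset.sum_bij' (fun x hx => (x.2.castLT
      (lt_of_le_of_lt (Finset.mem_filter.mp hx).2 x.1.is_lt), x.1.succ))
    (fun x hx => (x.2.pred (by
      rintro h0
      simp [S, h0] at hx), x.1.castSucc)) ?_ ?_ ?_ ?_ ?_
  · rintro ⟨i, j⟩ hx
    simp [S] at hx ⊢
    omega
  · rintro ⟨i, j⟩ hx
    simp [S] at hx ⊢
    omega
  · rintro ⟨i, j⟩ hx
    simp
  · rintro ⟨i, j⟩ hx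
    simp
  · rintro ⟨i, j⟩ hx
    have hx' : (j : ℕ) ≤ i := (Finset.mem_filter.mp hx).2
    have := h (j.castLT (lt_of_le_of_lt hx' i.is_lt)) i hx'
    simp only [Fin.castSucc_castLT] at this
    simp only [this, Fin.val_succ, Fin.val_castLT, ← neg_smul]
    congr 1
    ring

theorem pullback_congr {X Y : Type} [DiffeologicalSpace X] [DiffeologicalSpace Y] {φ ψ : X → Y}
    (h : ∀ x, φ x = ψ x) (hφ : DSmooth φ) (hψ : DSmooth ψ) (α : OneForm Y) :
    pullback φ hφ α = pullback ψ hψ α := by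
  obtain rfl : φ = ψ := funext h
  rfl

theorem dH_apply (p q : ℕ) (α : Cochain p q) : dH p q α =
    ∑ i : Fin (p + 2), (-1 : ℝ) ^ (i : ℕ) • pullback (hFace p q i) (dSmooth_hFace p q i) α := by
  simp [dH]

theorem dV_apply (p q : ℕ) (α : Cochain p q) : dV p q α =
    ∑ i : Fin (q + 2), (-1 : ℝ) ^ (i : ℕ) • pullback (vFace p q i) (dSmooth_vFace p q i) α := by
  simp [dV]

theorem dH_dH (p q : ℕ) (α : Cochain p q) : dH (p + 1) q (dH p q α) = 0 := by
  rw [dH_apply, dH_apply]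
  simp only [map_sum, map_smul]
  exact alternating_sum_eq_zero (fun i j =>
    pullback (hFace (p + 1) q j) (dSmooth_hFace _ _ _)
      (pullback (hFace p q i) (dSmooth_hFace _ _ _) α)) fun i j h =>
    pullback_congr (hFace_hFace p q i j h) ((dSmooth_hFace _ _ _).comp (dSmooth_hFace _ _ _))
      ((dSmooth_hFace _ _ _).comp (dSmooth_hFace _ _ _)) α

theorem dV_dV (p q : ℕ) (α : Cochain p q) : dV p (q + 1) (dV p q α) = 0 := by
  rw [dV_apply, dV_apply]
  simp only [map_sum, map_smul]
  exact alternating_sum_eq_zero (fun i j =>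
    pullback (vFace p (q + 1) j) (dSmooth_vFace _ _ _)
      (pullback (vFace p q i) (dSmooth_vFace _ _ _) α)) fun i j h =>
    pullback_congr (vFace_vFace p q i j h) ((dSmooth_vFace _ _ _).comp (dSmooth_vFace _ _ _))
      ((dSmooth_vFace _ _ _).comp (dSmooth_vFace _ _ _)) α

theorem dH_dV (p q : ℕ) (α : Cochain p q) : dH p (q + 1) (dV p q α) = dV (p + 1) q (dH p q α) := by
  rw [dH_apply, dV_apply, dV_apply, dH_apply]
  simp only [map_sum, map_smul, Finset.smul_sum]
  rw [Finset.sum_comm]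
  refine Finset.sum_congr rfl fun j _ => Finset.sum_congr rfl fun i _ => ?_
  rw [smul_comm]
  congr 2
  exact pullback_congr (fun z => (hFace_vFace p q i j z).symm)
    ((dSmooth_vFace _ _ _).comp (dSmooth_hFace _ _ _))
    ((dSmooth_hFace _ _ _).comp (dSmooth_vFace _ _ _)) α

/-! ### The total complex -/


/-- Families of one-forms on all the manifolds `Γ^p × F × ℝ^q`. -/
abbrev Bigraded : Type := (p q : ℕ) → Cochain p q

/-- The families concentrated in the bidegrees with `p + q + 1 = n`; the one is the degree of the forms. -/
def totSubmodule (n : ℕ) : Submodule ℝ Bigraded where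
  carrier := {c | ∀ p q, p + q + 1 ≠ n → c p q = 0}
  zero_mem' _ _ _ := rfl
  add_mem' ha hb p q h := by rw [Pi.add_apply, Pi.add_apply, ha p q h, hb p q h, add_zero]
  smul_mem' r a ha p q h := by rw [Pi.smul_apply, Pi.smul_apply, ha p q h, smul_zero]

/-- The piece `⊕ Ω¹(Γ^p × F × ℝ^q)`, over `p + q + 1 = n`, of degree `n` of the total complex. -/
def Tot (n : ℕ) : Type := totSubmodule n

instance (n : ℕ) : AddCommGroup (Tot n) := inferInstanceAs (AddCommGroup (totSubmodule n))

instance (n : ℕ) : Module ℝ (Tot n) := inferInstanceAs (Module ℝ (totSubmodule n))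

/-- The horizontal part of the total differential. -/
def hPart (c : Bigraded) : Bigraded
  | 0, _ => 0
  | p + 1, q => dH p q (c p q)

/-- The vertical part of the total differential, with the sign `(-1)^p`. -/
def vPart (c : Bigraded) : Bigraded
  | _, 0 => 0
  | p, q + 1 => (-1 : ℝ) ^ p • dV p q (c p q)


theorem hPart_add (a b : Bigraded) (p q : ℕ) :
    hPart (a + b) p q = hPart a p q + hPart b p q := by
  cases p with
  | zero => exact (add_zero _).symm
  | succ p => exact (dH p q).map_add (a p q) (b p q)

theorem hPart_smul (r : ℝ) (a : Bigraded) (p q : ℕ) :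
    hPart (r • a) p q = r • hPart a p q := by
  cases p with
  | zero => exact (smul_zero _).symm
  | succ p => exact (dH p q).map_smul r (a p q)

theorem vPart_add (a b : Bigraded) (p q : ℕ) :
    vPart (a + b) p q = vPart a p q + vPart b p q := by
  cases q with
  | zero => exact (add_zero _).symm
  | succ q =>
    change (-1 : ℝ) ^ p • dV p q (a p q + b p q) = _
    rw [map_add, smul_add]; rfl

theorem vPart_smul (r : ℝ) (a : Bigraded) (p q : ℕ) :
    vPart (r • a) p q = r • vPart a p q := by
  cases q with
  | zero => exact (smul_zero _).symm
  | succ q =>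
    change (-1 : ℝ) ^ p • dV p q (r • a p q) = _
    rw [map_smul, smul_comm]; rfl

theorem hPart_vPart_support {n : ℕ} (c : Tot n) (p q : ℕ) (h : p + q + 1 ≠ n + 1) :
    hPart c.1 p q + vPart c.1 p q = 0 := by
  have h1 : hPart c.1 p q = 0 := by
    cases p with
    | zero => rfl
    | succ p => rw [hPart, c.2 p q (by omega), map_zero]
  have h2 : vPart c.1 p q = 0 := by
    cases q with
    | zero => rfl
    | succ q => rw [vPart, c.2 p q (by omega), map_zero, smul_zero]
  rw [h1, h2, add_zero]

/-- The differential `d = d^h + (-1)^p d^v` of the total complex. -/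
def totalD (n : ℕ) : Tot n →ₗ[ℝ] Tot (n + 1) where
  toFun c := ⟨fun p q => hPart c.1 p q + vPart c.1 p q, hPart_vPart_support c⟩
  map_add' a b := Subtype.ext <| funext fun p => funext fun q => by
    change hPart (a.1 + b.1) p q + vPart (a.1 + b.1) p q =
      (hPart a.1 p q + vPart a.1 p q) + (hPart b.1 p q + vPart b.1 p q)
    rw [hPart_add, vPart_add, add_add_add_comm]
  map_smul' r a := Subtype.ext <| funext fun p => funext fun q => by
    change hPart (r • a.1) p q + vPart (r • a.1) p q = r • (hPart a.1 p q + vPart a.1 p q)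
    rw [hPart_smul, vPart_smul, smul_add]


/-- The total complex is a complex. -/
theorem totalD_totalD (n : ℕ) (c : Tot n) : totalD (n + 1) (totalD n c) = 0 := by
  refine Subtype.ext (funext fun p => funext fun q => ?_)
  change hPart (fun p q => hPart c.1 p q + vPart c.1 p q) p q +
    vPart (fun p q => hPart c.1 p q + vPart c.1 p q) p q = (0 : Cochain p q)
  have hh : ∀ p q, dH p q (hPart c.1 p q) = 0 := fun p q => by
    cases p with
    | zero => exact map_zero _
    | succ p => exact dH_dH p q _
  have vv : ∀ p q, dV p q (vPart c.1 p q) = 0 := fun p q => by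
    cases q with
    | zero => exact map_zero _
    | succ q => exact ((dV p (q + 1)).map_smul _ _).trans (by rw [dV_dV, smul_zero])
  have h1 : ∀ q, hPart (fun p q => hPart c.1 p q + vPart c.1 p q) 0 q = 0 := fun q => rfl
  have h2 : ∀ p q, hPart (fun p q => hPart c.1 p q + vPart c.1 p q) (p + 1) q =
      dH p q (vPart c.1 p q) := fun p q =>
    ((dH p q).map_add _ _).trans (by rw [hh, zero_add])
  have v1 : ∀ p, vPart (fun p q => hPart c.1 p q + vPart c.1 p q) p 0 = 0 := fun q => by
    cases q <;> rfl
  have v2 : ∀ p q, vPart (fun p q => hPart c.1 p q + vPart c.1 p q) p (q + 1) =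
      (-1 : ℝ) ^ p • dV p q (hPart c.1 p q) := fun p q =>
    congrArg (fun x => (-1 : ℝ) ^ p • x)
      (((dV p q).map_add _ _).trans (by rw [vv, add_zero]))
  have v3 : ∀ p, vPart c.1 p 0 = 0 := fun p => by cases p <;> rfl
  rcases p with _ | p
  · rcases q with _ | q
    · rw [h1, v1, add_zero]
    · rw [h1, v2, zero_add]
      exact (congrArg _ (map_zero (dV 0 q))).trans (smul_zero _)
  · rcases q with _ | q
    · rw [h2, v1, v3, map_zero, add_zero]
    · rw [h2, v2]
      change dH p (q + 1) ((-1 : ℝ) ^ p • dV p q (c.1 p q)) +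
        (-1 : ℝ) ^ (p + 1) • dV (p + 1) q (dH p q (c.1 p q)) = 0
      rw [map_smul, dH_dV, pow_succ]
      module

/-- The element `(a, b)` of `Ω¹(F × ℝ) ⊕ Ω¹(Γ × F)`, the degree two part of the total complex. -/
def tot₂ (a : Cochain 0 1) (b : Cochain 1 0) : Tot 2 :=
  ⟨fun p q => match p, q with
    | 0, 1 => a
    | 1, 0 => b
    | _, _ => 0, fun p q h => by
    dsimp only
    split
    · exact absurd rfl h
    · exact absurd rfl h
    · rfl⟩

/-- The element `(a, b, c)` of `Ω¹(F × ℝ²) ⊕ Ω¹(Γ × F × ℝ) ⊕ Ω¹(Γ² × F)`, the degree three part of the total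
complex. -/
def tot₃ (a : Cochain 0 2) (b : Cochain 1 1) (c : Cochain 2 0) : Tot 3 :=
  ⟨fun p q => match p, q with
    | 0, 2 => a
    | 1, 1 => b
    | 2, 0 => c
    | _, _ => 0, fun p q h => by
    dsimp only
    split
    · exact absurd rfl h
    · exact absurd rfl h
    · exact absurd rfl h
    · rfl⟩

/-- The coordinate `x_{i+1}`. -/
def coordX {p q : ℕ} (i : Fin q) (z : Level p q) : ℝ := z.2.2 i

/-- The function `log v`. -/
def logV {p q : ℕ} (z : Level p q) : ℝ := Real.log z.2.1.2

/-- The function `log γ'_{i+1}`, evaluated at `θ`. -/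
def logDeriv {p q : ℕ} (i : Fin p) (z : Level p q) : ℝ := Real.log ((z.1 i).deriv z.2.1.1)

/-- The function `log (γ'_{i+1} ∘ γ_{j+1})`, evaluated at `θ`. -/
def logDerivComp {p q : ℕ} (i j : Fin p) (z : Level p q) : ℝ :=
  Real.log ((z.1 i).deriv (z.1 j z.2.1.1))

section
variable {p q : ℕ}

theorem dSmooth_coordX (i : Fin q) : DSmooth (coordX i : Level p q → ℝ) :=
  (dSmooth_eval i).comp (dSmooth_snd.comp dSmooth_snd)

theorem dSmooth_logV : DSmooth (logV : Level p q → ℝ) := by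
  have h : DSmooth (fun z : Level p q => (z.2.1.2 : ℝ)) :=
    (dSmooth_val _).comp (dSmooth_snd.comp (dSmooth_fst.comp dSmooth_snd))
  exact dSmooth_log h fun z => z.2.1.2.2

theorem dSmooth_base : DSmooth (fun z : Level p q => z.2.1.1) :=
  dSmooth_fst.comp (dSmooth_fst.comp dSmooth_snd)

theorem dSmooth_diff (i : Fin p) : DSmooth (fun z : Level p q => z.1 i) :=
  (dSmooth_eval i).comp dSmooth_fst

theorem dSmooth_logDeriv (i : Fin p) : DSmooth (logDeriv i : Level p q → ℝ) :=
  dSmooth_log (dSmooth_deriv₂ (dSmooth_diff i) dSmooth_base) fun z => (z.1 i).deriv_pos _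

theorem dSmooth_logDerivComp (i j : Fin p) : DSmooth (logDerivComp i j : Level p q → ℝ) :=
  dSmooth_log (dSmooth_deriv₂ (dSmooth_diff i) (dSmooth_apply₂ (dSmooth_diff j) dSmooth_base))
    fun z => (z.1 i).deriv_pos _

end

/-- `x₁ dx₂` on `F × ℝ²`. -/
def xdx : Cochain 0 2 :=
  mulForm (coordX 0) (dSmooth_coordX 0) (dForm (coordX 1) (dSmooth_coordX 1))

/-- `log(γ₁' ∘ γ₂) d log γ₂'` on `Γ² × F`. -/
def bottForm : Cochain 2 0 :=
  mulForm (logDerivComp 0 1) (dSmooth_logDerivComp 0 1) (dForm (logDeriv 1) (dSmooth_logDeriv 1))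

/-- `- log v dx` on `F × ℝ`. -/
def negLogVdx : Cochain 0 1 :=
  mulForm (fun z => -logV z) (dSmooth_neg dSmooth_logV) (dForm (coordX 0) (dSmooth_coordX 0))

/-- `log γ' d log v` on `Γ × F`. -/
def logDerivDlogV : Cochain 1 0 :=
  mulForm (logDeriv 0) (dSmooth_logDeriv 0) (dForm logV dSmooth_logV)

/-- `z₁ = (x₁ dx₂, 0, 0)`. -/
def z₁ : Tot 3 := tot₃ xdx 0 0
/-- `z₂ = (0, 0, log(γ₁' ∘ γ₂) d log γ₂')`. -/
def z₂ : Tot 3 := tot₃ 0 0 bottForm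
/-- `β = (- log v dx, log γ' d log v)`. -/
def β : Tot 2 := tot₂ negLogVdx logDerivDlogV

end BottThurston

end

/-! Write `ℓ = log γ'` and `λ = log v`. The function `ℓ` is a group cocycle of `Γ` by the chain
rule, and `x` is a group cocycle of `ℝ` because it is additive. The frame coordinate `λ` links the
two: the left action changes it by `ℓ` and the right action by `x`. With the signs of the faces, the
function `λ` on `F` has horizontal coboundary `-ℓ` and vertical coboundary `x`, so `x` and `ℓ` are
cohomologous on the bisimplicial manifold.

The elements `z₁` and `z₂` are the cup products `x ∪ dx` and `ℓ ∪ dℓ`, hence cohomologous too.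
Splitting the difference as `x ∪ dx - ℓ ∪ dℓ = (x - ℓ) ∪ dx + ℓ ∪ d(x - ℓ)` and replacing `x - ℓ` by
the coboundary of `λ` produces, up to sign, the cochain `β = (-λ dx, ℓ dλ)`.

The proof checks this by components. `dV_negLogVdx` gives the corner `-x₁ dx₂`, and
`dH_logDerivDlogV` gives the corner `log(γ₁' ∘ γ₂) d log γ₂'`. In the mixed bidegree both
`dH_negLogVdx` and `dV_logDerivDlogV` give `ℓ dx`, and the sign `(-1)^p` makes them cancel. That
`z₁` is a cocycle is the bilinear identity `dV_xdx` together with `dH_xdx`. Then `z₂ = z₁ + dβ` is a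
cocycle because the total differential squares to zero. -/

noncomputable section

namespace BottThurston

/-! ### Pullback and bilinearity for forms `f dg` -/

section
variable {X Y : Type} [DiffeologicalSpace X] [DiffeologicalSpace Y]

/-- Pullback commutes with products and with `d`, so only the two functions have to be composed with
the face map. The free target `η` allows the result to be recorded already expanded into monomials,
with the expansion as the last hypothesis. -/
theorem pullback_mulForm_dForm {φ : X → Y} {f g : Y → ℝ} {f' g' : X → ℝ} (hφ : DSmooth φ)
    (hf : DSmooth f) (hg : DSmooth g) (hf' : DSmooth f') (hg' : DSmooth g')
    (h₁ : ∀ x, f (φ x) = f' x) (h₂ : ∀ x, g (φ x) = g' x) {η : OneForm X}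
    (h : mulForm f' hf' (dForm g' hg') = η) :
    pullback φ hφ (mulForm f hf (dForm g hg)) = η := by
  obtain rfl : (fun x => f (φ x)) = f' := funext h₁
  obtain rfl : (fun x => g (φ x)) = g' := funext h₂
  exact h

theorem oneForm_ext {α β : OneForm X} (h : ∀ n p u, α.1 n p u = β.1 n p u) : α = β :=
  Subtype.ext <| funext fun n => funext fun p => funext fun u => h n p u

theorem mulForm_add_left {f g : X → ℝ} (hf : DSmooth f) (hg : DSmooth g) (α : OneForm X) :
    mulForm (fun x => f x + g x) (dSmooth_add hf hg) α = mulForm f hf α + mulForm g hg α :=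
  oneForm_ext fun _ p _ => add_smul (f (p.1 _)) (g (p.1 _)) _

theorem mulForm_neg_left {f : X → ℝ} (hf : DSmooth f) (α : OneForm X) :
    mulForm (fun x => -f x) (dSmooth_neg hf) α = -mulForm f hf α :=
  oneForm_ext fun _ p u => neg_smul (f (p.1 u)) (α.1 _ p u)

theorem mulForm_add_right {f : X → ℝ} (hf : DSmooth f) (α β : OneForm X) :
    mulForm f hf (α + β) = mulForm f hf α + mulForm f hf β :=
  oneForm_ext fun _ p u => smul_add (f (p.1 _)) (α.1 _ p u) (β.1 _ p u)

/-- Along each plot this is additivity of the Fréchet derivative. Unlike the pointwise identities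
for `mulForm`, it needs differentiability, which smoothness along plots supplies. -/
theorem dForm_add {f g : X → ℝ} (hf : DSmooth f) (hg : DSmooth g) :
    dForm (fun x => f x + g x) (dSmooth_add hf hg) = dForm f hf + dForm g hg :=
  oneForm_ext fun n p u =>
    fderiv_fun_add ((hf n p.1 p.2).contDiff.contDiffAt.differentiableAt (by simp))
      ((hg n p.1 p.2).contDiff.contDiffAt.differentiableAt (by simp))

end

/-! ### Logarithmic cocycle identities -/

theorem logV_leftAct (γ : DiffPlus) (f : Frame) :
    Real.log (leftAct γ f).2 = Real.log (γ.deriv f.1) + Real.log f.2 :=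
  Real.log_mul (γ.deriv_pos _).ne' f.2.2.ne'

theorem logV_rightAct (f : Frame) (x : ℝ) :
    Real.log (rightAct f x).2 = x + Real.log f.2 :=
  (Real.log_mul (Real.exp_pos x).ne' f.2.2.ne').trans (by rw [Real.log_exp])

/-- The logarithm of the chain rule: this is what makes `log γ'` a 1-cocycle of `Γ` with values in
functions on the circle. -/
theorem log_deriv_mul (γ₁ γ₂ : DiffPlus) (θ : Circle) :
    Real.log ((γ₁ * γ₂).deriv θ) = Real.log (γ₁.deriv (γ₂ θ)) + Real.log (γ₂.deriv θ) := by
  rw [DiffPlus.deriv_mul, Real.log_mul (γ₁.deriv_pos _).ne' (γ₂.deriv_pos _).ne']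

/-! ### Horizontal and vertical differentials of the individual components -/

/-- The form is a cup product of two additive cocycles. With `M i j` for `x_{i+1} dx_{j+1}`, the
alternating sum over the four faces is `M 1 2 - (M 0 2 + M 1 2) + (M 0 1 + M 0 2) - M 0 1`. The
action on `F` in the first face plays no role, since the form does not involve `F`. -/
theorem dV_xdx : dV 0 2 xdx = 0 := by
  let X (i : Fin 3) : Level 0 3 → ℝ := coordX i
  have hX (i) : DSmooth (X i) := dSmooth_coordX i
  let M (i j : Fin 3) : Cochain 0 3 := mulForm (X i) (hX i) (dForm (X j) (hX j))
  have e0 : pullback (vFace 0 2 0) (dSmooth_vFace 0 2 0) xdx = M 1 2 :=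
    pullback_mulForm_dForm (dSmooth_vFace 0 2 0) (dSmooth_coordX 0) (dSmooth_coordX 1)
      _ _ (fun _ => rfl) (fun _ => rfl) rfl
  have e1 : pullback (vFace 0 2 1) (dSmooth_vFace 0 2 1) xdx = M 0 2 + M 1 2 :=
    pullback_mulForm_dForm (dSmooth_vFace 0 2 1) (dSmooth_coordX 0) (dSmooth_coordX 1)
      (dSmooth_add (hX 0) (hX 1)) (hX 2) (fun _ => rfl)
      (fun _ => rfl) (mulForm_add_left _ _ _)
  have e2 : pullback (vFace 0 2 2) (dSmooth_vFace 0 2 2) xdx = M 0 1 + M 0 2 :=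
    pullback_mulForm_dForm (dSmooth_vFace 0 2 2) (dSmooth_coordX 0) (dSmooth_coordX 1)
      (hX 0) (dSmooth_add (hX 1) (hX 2)) (fun _ => rfl)
      (fun _ => rfl) (by rw [dForm_add, mulForm_add_right])
  have e3 : pullback (vFace 0 2 3) (dSmooth_vFace 0 2 3) xdx = M 0 1 :=
    pullback_mulForm_dForm (dSmooth_vFace 0 2 3) (dSmooth_coordX 0) (dSmooth_coordX 1)
      _ _ (fun _ => rfl) (fun _ => rfl) rfl
  rw [dV_apply, Fin.sum_univ_four, e0, e1, e2, e3]
  norm_num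

/-- Both horizontal faces leave the `ℝ`-coordinates alone, so the two pullbacks are equal and enter
with opposite signs. -/
theorem dH_xdx : dH 0 2 xdx = 0 := by
  have e (i : Fin 2) : pullback (hFace 0 2 i) (dSmooth_hFace 0 2 i) xdx =
      mulForm (coordX 0) (dSmooth_coordX 0) (dForm (coordX 1) (dSmooth_coordX 1)) := by
    fin_cases i <;>
      exact pullback_mulForm_dForm (dSmooth_hFace 0 2 _) (dSmooth_coordX 0) (dSmooth_coordX 1)
        _ _ (fun _ => rfl) (fun _ => rfl) rfl
  rw [dH_apply, Fin.sum_univ_two, e, e]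
  norm_num

/-- Only the first face moves the frame. It replaces `log v` by `x₁ + log v`, and the extra `x₁` is
what survives; the terms with coefficient `log v` cancel because `dx` is additive. -/
theorem dV_negLogVdx : dV 0 1 negLogVdx = -xdx := by
  let X (i : Fin 2) : Level 0 2 → ℝ := coordX i
  have hX (i) : DSmooth (X i) := dSmooth_coordX i
  have hV : DSmooth (logV : Level 0 2 → ℝ) := dSmooth_logV
  let M (i : Fin 2) : Cochain 0 2 := mulForm logV hV (dForm (X i) (hX i))
  have e0 : pullback (vFace 0 1 0) (dSmooth_vFace 0 1 0) negLogVdx = -(xdx + M 1) :=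
    pullback_mulForm_dForm (dSmooth_vFace 0 1 0) (dSmooth_neg dSmooth_logV) (dSmooth_coordX 0)
      (dSmooth_neg (dSmooth_add (hX 0) hV)) (hX 1)
      (fun z => congrArg Neg.neg (logV_rightAct z.2.1 (z.2.2 0))) (fun _ => rfl)
      -- The face has moved `x₂` into the slot of `dx`, so the summand with coefficient `x₁` is
      -- `xdx` by definition.
      (by rw [mulForm_neg_left (dSmooth_add (hX 0) hV), mulForm_add_left]; rfl)
  have e1 : pullback (vFace 0 1 1) (dSmooth_vFace 0 1 1) negLogVdx = -(M 0 + M 1) :=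
    pullback_mulForm_dForm (dSmooth_vFace 0 1 1) (dSmooth_neg dSmooth_logV) (dSmooth_coordX 0)
      (dSmooth_neg hV) (dSmooth_add (hX 0) (hX 1)) (fun _ => rfl)
      (fun _ => rfl) (by rw [mulForm_neg_left, dForm_add, mulForm_add_right])
  have e2 : pullback (vFace 0 1 2) (dSmooth_vFace 0 1 2) negLogVdx = -M 0 :=
    pullback_mulForm_dForm (dSmooth_vFace 0 1 2) (dSmooth_neg dSmooth_logV) (dSmooth_coordX 0)
      (dSmooth_neg hV) (hX 0) (fun _ => rfl)
      (fun _ => rfl) (mulForm_neg_left _ _)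
  rw [dV_apply, Fin.sum_univ_three, e0, e1, e2]
  norm_num
  module

/-- The second face lets `γ` act on the frame and shifts `log v` by `log γ'`. Its sign `-1` cancels
the minus sign in `-log v dx`. -/
theorem dH_negLogVdx : dH 0 1 negLogVdx =
    mulForm (logDeriv 0) (dSmooth_logDeriv 0) (dForm (coordX 0) (dSmooth_coordX 0)) := by
  have hX : DSmooth (coordX 0 : Level 1 1 → ℝ) := dSmooth_coordX 0
  have hV : DSmooth (logV : Level 1 1 → ℝ) := dSmooth_logV
  have hD : DSmooth (logDeriv 0 : Level 1 1 → ℝ) := dSmooth_logDeriv 0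
  have e0 : pullback (hFace 0 1 0) (dSmooth_hFace 0 1 0) negLogVdx =
      -mulForm logV hV (dForm (coordX 0) hX) :=
    pullback_mulForm_dForm (dSmooth_hFace 0 1 0) (dSmooth_neg dSmooth_logV) (dSmooth_coordX 0)
      (dSmooth_neg hV) hX (fun _ => rfl)
      (fun _ => rfl) (mulForm_neg_left _ _)
  have e1 : pullback (hFace 0 1 1) (dSmooth_hFace 0 1 1) negLogVdx =
      -(mulForm (logDeriv 0) hD (dForm (coordX 0) hX) +
        mulForm logV hV (dForm (coordX 0) hX)) :=
    pullback_mulForm_dForm (dSmooth_hFace 0 1 1) (dSmooth_neg dSmooth_logV) (dSmooth_coordX 0)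
      (dSmooth_neg (dSmooth_add hD hV)) hX
      (fun z => congrArg Neg.neg (logV_leftAct (z.1 0) z.2.1)) (fun _ => rfl)
      (by rw [mulForm_neg_left (dSmooth_add hD hV), mulForm_add_left])
  rw [dH_apply, Fin.sum_univ_two, e0, e1]
  norm_num

/-- The right action fixes the base point, hence also `log γ'`, and shifts `d log v` by `dx`. -/
theorem dV_logDerivDlogV : dV 1 0 logDerivDlogV =
    mulForm (logDeriv 0) (dSmooth_logDeriv 0) (dForm (coordX 0) (dSmooth_coordX 0)) := by
  have hX : DSmooth (coordX 0 : Level 1 1 → ℝ) := dSmooth_coordX 0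
  have hV : DSmooth (logV : Level 1 1 → ℝ) := dSmooth_logV
  have hD : DSmooth (logDeriv 0 : Level 1 1 → ℝ) := dSmooth_logDeriv 0
  have e0 : pullback (vFace 1 0 0) (dSmooth_vFace 1 0 0) logDerivDlogV =
      mulForm (logDeriv 0) hD (dForm (coordX 0) hX) + mulForm (logDeriv 0) hD (dForm logV hV) :=
    pullback_mulForm_dForm (dSmooth_vFace 1 0 0) (dSmooth_logDeriv 0) dSmooth_logV
      hD (dSmooth_add hX hV) (fun _ => rfl)
      (fun z => logV_rightAct z.2.1 (z.2.2 0)) (by rw [dForm_add, mulForm_add_right])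
  have e1 : pullback (vFace 1 0 1) (dSmooth_vFace 1 0 1) logDerivDlogV =
      mulForm (logDeriv 0) hD (dForm logV hV) :=
    pullback_mulForm_dForm (dSmooth_vFace 1 0 1) (dSmooth_logDeriv 0) dSmooth_logV
      _ _ (fun _ => rfl) (fun _ => rfl) rfl
  rw [dV_apply, Fin.sum_univ_two, e0, e1]
  norm_num

/-- The chain rule in the middle face produces the two `d log v` terms that cancel those of the
outer faces. What remains is the shift of `d log v` by `d log γ₂'` in the last face. -/
theorem dH_logDerivDlogV : dH 1 0 logDerivDlogV = bottForm := by
  have hV : DSmooth (logV : Level 2 0 → ℝ) := dSmooth_logV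
  have hD : DSmooth (logDeriv 1 : Level 2 0 → ℝ) := dSmooth_logDeriv 1
  have hC : DSmooth (logDerivComp 0 1 : Level 2 0 → ℝ) := dSmooth_logDerivComp 0 1
  have e0 : pullback (hFace 1 0 0) (dSmooth_hFace 1 0 0) logDerivDlogV =
      mulForm (logDeriv 1) hD (dForm logV hV) :=
    pullback_mulForm_dForm (dSmooth_hFace 1 0 0) (dSmooth_logDeriv 0) dSmooth_logV
      _ _ (fun _ => rfl) (fun _ => rfl) rfl
  have e1 : pullback (hFace 1 0 1) (dSmooth_hFace 1 0 1) logDerivDlogV =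
      mulForm (logDerivComp 0 1) hC (dForm logV hV) + mulForm (logDeriv 1) hD (dForm logV hV) :=
    pullback_mulForm_dForm (dSmooth_hFace 1 0 1) (dSmooth_logDeriv 0) dSmooth_logV
      (dSmooth_add hC hD) hV
      (fun z => log_deriv_mul (z.1 0) (z.1 1) z.2.1.1) (fun _ => rfl) (mulForm_add_left _ _ _)
  -- The last face also moves the base point to `γ₂(θ)`, so the coefficient becomes `log(γ₁' ∘ γ₂)`.
  have e2 : pullback (hFace 1 0 2) (dSmooth_hFace 1 0 2) logDerivDlogV =
      bottForm + mulForm (logDerivComp 0 1) hC (dForm logV hV) :=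
    pullback_mulForm_dForm (dSmooth_hFace 1 0 2) (dSmooth_logDeriv 0) dSmooth_logV
      hC (dSmooth_add hD hV) (fun _ => rfl)
      (fun z => logV_leftAct (z.1 1) z.2.1) (by rw [dForm_add, mulForm_add_right]; rfl)
  rw [dH_apply, Fin.sum_univ_three, e0, e1, e2]
  norm_num

/-! ### Assembly in the total complex -/

theorem z₂_sub_z₁ : z₂ - z₁ = tot₃ (-xdx) 0 bottForm := by
  refine Subtype.ext (funext fun p => funext fun q => ?_)
  change (tot₃ 0 0 bottForm).1 p q - (tot₃ xdx 0 0).1 p q = _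
  simp only [tot₃]
  split <;> simp

theorem totalD_β : totalD 2 β = tot₃ (-xdx) 0 bottForm := by
  refine Subtype.ext (funext fun p => funext fun q => ?_)
  by_cases h : p + q + 1 = 3
  · obtain ⟨rfl, rfl⟩ | ⟨rfl, rfl⟩ | ⟨rfl, rfl⟩ :
        (p = 0 ∧ q = 2) ∨ (p = 1 ∧ q = 1) ∨ (p = 2 ∧ q = 0) := by omega
    -- In column `p = 0` the horizontal part is zero by definition; in row `q = 0` the vertical part
    -- is.
    · change 0 + (-1 : ℝ) ^ 0 • dV 0 1 negLogVdx = -xdx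
      rw [dV_negLogVdx, pow_zero, one_smul, zero_add]
    -- Both terms are `log γ' dx` up to the sign `(-1)^p` with `p = 1`, so they cancel.
    · change dH 0 1 negLogVdx + (-1 : ℝ) ^ 1 • dV 1 0 logDerivDlogV = 0
      rw [dH_negLogVdx, dV_logDerivDlogV, pow_one, neg_one_smul, add_neg_cancel]
    · change dH 1 0 logDerivDlogV + 0 = bottForm
      rw [dH_logDerivDlogV, add_zero]
  · rw [(totalD 2 β).2 p q h, (tot₃ (-xdx) 0 bottForm).2 p q h]

theorem totalD_z₁ : totalD 3 z₁ = 0 := by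
  refine Subtype.ext (funext fun p => funext fun q => ?_)
  change _ = (0 : Cochain p q)
  by_cases h : p + q + 1 = 4
  · obtain ⟨rfl, rfl⟩ | ⟨rfl, rfl⟩ | ⟨rfl, rfl⟩ | ⟨rfl, rfl⟩ :
        (p = 0 ∧ q = 3) ∨ (p = 1 ∧ q = 2) ∨ (p = 2 ∧ q = 1) ∨ (p = 3 ∧ q = 0) := by omega
    · change 0 + (-1 : ℝ) ^ 0 • dV 0 2 xdx = 0
      rw [dV_xdx, smul_zero, add_zero]
    · change dH 0 2 xdx + (-1 : ℝ) ^ 1 • dV 1 1 0 = 0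
      rw [dH_xdx, map_zero, smul_zero, add_zero]
    · change dH 1 1 0 + (-1 : ℝ) ^ 2 • dV 2 0 0 = 0
      rw [map_zero, map_zero, smul_zero, add_zero]
    · change dH 2 0 0 + 0 = 0
      rw [map_zero, add_zero]
  · exact (totalD 3 z₁).2 p q h

theorem totalD_β_eq_sub : totalD 2 β = z₂ - z₁ := totalD_β.trans z₂_sub_z₁.symm

/-- Applying `d² = 0` to `β` gives `d z₂ = d z₁`, which avoids computing the horizontal differential
of the form on `Γ² × F`. -/
theorem totalD_z₂ : totalD 3 z₂ = 0 := by
  have h := totalD_totalD 2 β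
  rwa [totalD_β_eq_sub, map_sub, totalD_z₁, sub_zero] at h

end BottThurston

end

theorem mainTheorem3 :
    BottThurston.totalD 3 BottThurston.z₁ = 0 ∧
    BottThurston.totalD 3 BottThurston.z₂ = 0 ∧
    BottThurston.z₂ - BottThurston.z₁ =
      BottThurston.tot₃ (-BottThurston.xdx) 0 BottThurston.bottForm ∧
    BottThurston.totalD 2 BottThurston.β = BottThurston.z₂ - BottThurston.z₁ ∧
    BottThurston.z₂ - BottThurston.z₁ ∈ LinearMap.range (BottThurston.totalD 2) :=
  ⟨BottThurston.totalD_z₁, BottThurston.totalD_z₂, BottThurston.z₂_sub_z₁,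
    BottThurston.totalD_β_eq_sub, BottThurston.β, BottThurston.totalD_β_eq_sub⟩
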